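/- Let $d\ge 2$ and $[d]=\{1,\dots,d\}$. A (finite) $d$-type plane forest is a finite ordered sequence of finite rooted plane trees (the children of every vertex are ordered from left to right), each vertex $u$ of which carries a type in $[d]$, such that the types of the children of any given vertex are nondecreasing from left to right. Forests are considered up to isomorphism preserving these orders and the types. The breadth-first order of a forest explores the trees one after the other, and each tree generation by generation, from left to right in each generation. For $i\in[d]$, a subtree of type $i$ of a forest $\mathbf f$ is a maximal connected set of vertices of type $i$. The subforest $\mathbf f^{(i)}$ of type $i$ is the sequence of the subtrees of type $i$, ranked by the breadth-first order in $\mathbf f$ of their roots. Let $u^{(i)}_1,\dots,u^{(i)}_{n_i}$ be the vertices of $\mathbf f^{(i)}$ in the breadth-first order of $\mathbf f^{(i)}$ (subtree after subtree), and let $p_j(u)$ be the number of children of type $j$ of $u$ in $\mathbf f$. The coding sequence $\Psi(\mathbf f)=x=(x^{i,j}_k,\ 0\le k\le n_i,\ i,j\in[d])$ is defined by $x^{i,j}_0=0$ and $$x^{i,j}_{k}-x^{i,j}_{k-1}=p_j(u^{(i)}_{k})-\mathbf 1_{\{i=j\}},\qquad 1\le k\le n_i .$$ The root type sequence $\mathrm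 c_{\mathbf f}$ is the sequence of the types of the roots of the successive trees of $\mathbf f$. Let $S_d$ be the set of families $x=(x^{i,j}_k,\ 0\le k\le n_i,\ i,j\in[d])$ of integers, with length $\mathrm n=(n_1,\dots,n_d)\in\mathbb Z_+^d$, such that $x^{i,j}_0=0$ for all $i,j$, the sequence $k\mapsto x^{i,j}_k$ is nondecreasing for $i\ne j$, and $x^{i,i}_{k+1}-x^{i,i}_k\ge-1$ for $0\le k<n_i$. For $\mathrm r=(r_1,\dots,r_d)\in\mathbb Z_+^d$ and $x\in S_d$ with length $\mathrm n$, a solution of the system $(\mathrm r,x)$ is an $\mathrm s\in\mathbb Z_+^d$ with $s_i\le n_i$ for all $i$ and $$r_j+\sum_{i=1}^d x^{i,j}_{s_i}=0,\qquad j\in[d];$$ the smallest solution is the solution that is coordinatewise less than or equal to every solution. Let $\mathrm r\in\mathbb Z_+^d$ with $r_1+\dots+r_d\ge1$, and let * $C_d^{\mathrm r}$ be the set of words in $[d]$ of length $r_1+\dots+r_d$ in which each $i\in[d]$ occurs exactly $r_i$ times; * $\mathcal F_d^{\mathrm r}$ be the set of $d$-type plane forests with $r_1+\dots+r_d$ trees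 that contain at least one vertex of each type and whose root type sequence belongs to $C_d^{\mathrm r}$; * $S_d^{\mathrm r}$ be the set of $x\in S_d$ whose length $\mathrm n$ satisfies $n_i\ge1$ for all $i$ and is the smallest solution of the system $(\mathrm r,x)$. Then the map $\Phi(\mathbf f)=(\Psi(\mathbf f),\mathrm c_{\mathbf f})$ is a bijection from $\mathcal F_d^{\mathrm r}$ onto $S_d^{\mathrm r}\times C_d^{\mathrm r}$. -/

import Mathlib

/-- A (finite) `d`-type plane forest, with vertices in Ulam–Harris form.  The root of the `a`-th tree
has address `[a]`, and the `k`-th child of the vertex `u` has address `k :: u` (addresses are read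
from the vertex up to its root; indices start at `0`).  The partial function `typ` is the type map:
its domain is the vertex set, and `typ u = some i` says that `u` is a vertex of type `i`. -/
@[ext]
structure TypedForest (d : ℕ) where
  /-- the type of a vertex, `none` off the vertex set -/
  typ : List ℕ → Option (Fin d)
  typ_nil : typ [] = none
  finite_verts : {u | typ u ≠ none}.Finite
  parent_mem : ∀ (u : List ℕ) (k : ℕ), u ≠ [] → typ (k :: u) ≠ none → typ u ≠ none
  /-- trees, and the children of any vertex, are numbered without gaps from left to right -/
  left_mem : ∀ (u : List ℕ) (k : ℕ), typ ((k + 1) :: u) ≠ none → typ (k :: u) ≠ none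
  /-- the types of the children of a vertex are nondecreasing from left to right -/
  sorted : ∀ (u : List ℕ) (k l : ℕ) (i j : Fin d), u ≠ [] → k ≤ l →
    typ (k :: u) = some i → typ (l :: u) = some j → i ≤ j

namespace TypedForest

/-- Breadth-first position of a vertex in a forest: trees one after the other, in each tree
generation by generation, and in each generation from left to right. -/
def bfsKey (u : List ℕ) : ℕ ×ₗ ℕ ×ₗ List ℕ :=
  toLex (u.getLastD 0, toLex (u.length, u.reverse))

theorem bfsKey_injective : Function.Injective bfsKey := by
  intro u v h
  have h1 := congrArg (fun p => (ofLex (ofLex p).2).2) h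
  exact List.reverse_injective h1

variable {d : ℕ} (f : TypedForest d)

/-- The root of the monochromatic subtree that contains `u`: the highest ancestor of `u` that is
reached from `u` through vertices of the same type as `u`. -/
def subtreeRoot : List ℕ → List ℕ
  | [] => []
  | k :: u => if f.typ u = f.typ (k :: u) then subtreeRoot u else k :: u

/-- Breadth-first position of a vertex in the subforest of its type: the subtrees of that type are
ranked by the order of their roots in the forest, and each is explored breadth first. -/
def subforestKey (u : List ℕ) : (ℕ ×ₗ ℕ ×ₗ List ℕ) ×ₗ (ℕ ×ₗ ℕ ×ₗ List ℕ) :=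
  toLex (bfsKey (f.subtreeRoot u), bfsKey u)

theorem subforestKey_injective : Function.Injective f.subforestKey := by
  intro u v h
  exact bfsKey_injective (congrArg (fun p => (ofLex p).2) h)

/-- `u` comes before `v`, or is equal to `v`, in the breadth-first order of the subforest. -/
def SubforestLE (u v : List ℕ) : Prop := f.subforestKey u ≤ f.subforestKey v

noncomputable instance : DecidableRel f.SubforestLE := fun _ _ => Classical.propDecidable _

instance : Std.Total f.SubforestLE := ⟨fun _ _ => le_total _ _⟩

instance : IsTrans (List ℕ) f.SubforestLE := ⟨fun _ _ _ h h' => le_trans h h'⟩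

instance : Std.Antisymm f.SubforestLE :=
  ⟨fun _ _ h h' => f.subforestKey_injective (le_antisymm h h')⟩

theorem finite_verts_of_typ (i : Fin d) : {u | f.typ u = some i}.Finite :=
  f.finite_verts.subset fun u hu => by
    have hu' : f.typ u = some i := hu
    simp [hu']

/-- The vertices of type `i`. -/
noncomputable def typeVerts (i : Fin d) : Finset (List ℕ) := (f.finite_verts_of_typ i).toFinset

/-- The vertices of the subforest of type `i`, listed in the breadth-first order of that
subforest. -/
noncomputable def subforestList (i : Fin d) : List (List ℕ) :=
  (f.typeVerts i).sort f.SubforestLE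

/-- The number of children of type `j` of the vertex `u`. -/
noncomputable def numChildren (j : Fin d) (u : List ℕ) : ℕ :=
  {k : ℕ | f.typ (k :: u) = some j}.ncard

/-- The step at a vertex `u` of type `i` of the `j`-th coordinate of the `i`-th chain. -/
noncomputable def step (i j : Fin d) (u : List ℕ) : ℤ :=
  (f.numChildren j u : ℤ) - if i = j then 1 else 0

/-- The number of trees. -/
noncomputable def numTrees : ℕ := {a : ℕ | f.typ [a] ≠ none}.ncard

/-- The root type sequence: the types of the roots of the successive trees. -/
noncomputable def rootTypes : List (Fin d) :=
  (List.range f.numTrees).filterMap fun a => f.typ [a]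

end TypedForest

/-- A coding sequence of finite length `(len 0, …, len (d - 1))`: for each `i` a `ℤ^d`-valued
sequence `val i` on `{0, …, len i}` that starts at `0`, whose coordinates `j ≠ i` are nondecreasing
and whose `i`-th coordinate is downward skip free. -/
structure CodingSeq (d : ℕ) where
  len : Fin d → ℕ
  val : (i : Fin d) → Fin (len i + 1) → Fin d → ℤ
  val_zero : ∀ i, val i 0 = 0
  mono : ∀ i j, i ≠ j → Monotone fun k => val i k j
  skip_free : ∀ (i : Fin d) (k : Fin (len i)), -1 ≤ val i k.succ i - val i k.castSucc i

namespace CodingSeq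

variable {d : ℕ}

/-- `s` (with `s ≤ x.len`) solves the system `(r, x)`: `r j + ∑ i, x^{i,j}(s i) = 0` for all `j`. -/
def IsSolution (r : Fin d → ℕ) (x : CodingSeq d) (s : (i : Fin d) → Fin (x.len i + 1)) : Prop :=
  ∀ j, (r j : ℤ) + ∑ i, x.val i (s i) j = 0

end CodingSeq

namespace TypedForest

variable {d : ℕ} (f : TypedForest d)

theorem sum_take_succ_step (i j : Fin d) (k : ℕ) (hk : k < (f.subforestList i).length) :
    (((f.subforestList i).take (k + 1)).map (f.step i j)).sum =
      (((f.subforestList i).take k).map (f.step i j)).sum +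
        f.step i j (f.subforestList i)[k] := by
  rw [List.take_add_one, List.getElem?_eq_getElem hk, List.map_append, List.sum_append]
  simp only [Option.toList_some, List.map_cons, List.map_nil, List.sum_cons, List.sum_nil, add_zero]

/-- The breadth-first coding `Ψ` of a forest: at time `k`, the `i`-th chain is the sum of the steps
at the first `k` vertices of the subforest of type `i`. -/
noncomputable def Psi : CodingSeq d where
  len i := (f.subforestList i).length
  val i k j := (((f.subforestList i).take k).map (f.step i j)).sum
  val_zero i := by
    funext j
    simp
  mono i j hij := by
    refine Fin.monotone_iff_le_succ.2 fun k => ?_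
    have h := f.sum_take_succ_step i j k k.2
    simp only [Fin.val_succ, Fin.val_castSucc]
    rw [h]
    simp [step, hij]
  skip_free i k := by
    have h := f.sum_take_succ_step i i k k.2
    simp only [Fin.val_succ, Fin.val_castSucc]
    rw [h, add_sub_cancel_left]
    unfold step
    rw [if_pos rfl]
    linarith [Int.natCast_nonneg (f.numChildren i (f.subforestList i)[(k : ℕ)])]

/-- The map `Φ`: the breadth-first coding together with the root type sequence. -/
noncomputable def Phi (f : TypedForest d) : CodingSeq d × List (Fin d) := (f.Psi, f.rootTypes)

end TypedForest

/-- `C_d^r`: the words of length `r_1 + ⋯ + r_d` in which each type `i` occurs `r i` times. -/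
def rootSeqSet {d : ℕ} (r : Fin d → ℕ) : Set (List (Fin d)) :=
  {c | c.length = ∑ i, r i ∧ ∀ i, c.count i = r i}

/-- `F_d^r`: the forests with `r_1 + ⋯ + r_d` trees that have at least one vertex of each type and
whose root type sequence is in `C_d^r`. -/
def forestSet {d : ℕ} (r : Fin d → ℕ) : Set (TypedForest d) :=
  {f | f.numTrees = ∑ i, r i ∧ (∀ i, ∃ u, f.typ u = some i) ∧ f.rootTypes ∈ rootSeqSet r}

/-- `S_d^r`: the coding sequences with positive lengths whose length vector is the smallest
solution of the system `(r, x)`. -/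
def codingSet {d : ℕ} (r : Fin d → ℕ) : Set (CodingSeq d) :=
  {x | (∀ i, 1 ≤ x.len i) ∧ IsLeast {s | x.IsSolution r s} fun i => Fin.last (x.len i)}

/-!
All vertices of a forest `f`, whatever their types, are ordered by `subforestKey`: first by the root
of the monochromatic subtree, then breadth first within the subtree.  Restricted to type `i`, this
is the order of the subforest of type `i`, and a vertex always precedes its children
(`subforestKey_lt_cons`).  So `f` can be explored along a single order, one vertex at a time, and
the `i`-th chain of `Ψ f` is the sum of the steps over the vertices of type `i` explored so far
(`Psi_valAt`).  If `A` is a set of explored vertices, the left side of the `j`-th equation of the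
system is the number of vertices of type `j` that are roots or children of vertices in `A`, minus
the number of vertices of type `j` in `A` (`count_rootTypes_add_sum_step`).

*The length is the smallest solution* (`isLeast_len_Psi`).  A solution `s` gives a set `A`, the
first `s i` vertices of each type `i`.  If `A` is not everything, let `v` be the first vertex
outside, of type `j` say.  The vertices that precede `v` are in `A`; hence `v` and all vertices of
type `j` in `A` are roots or have their parent in `A`, and the `j`-th equation fails
(`eq_verts_of_card_reached_le`).

*Injectivity* (`Phi_injective`).  Let `f` and `g` have the same image, and agree on an initial
segment `A` and on the children of `A`.  The key of the next vertex depends only on the types of its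
ancestors, so the next vertex is the same in both; the coding gives the numbers of its children of
each type, which determine the children since they are sorted by type.  So `A` can be enlarged
(`AgreeOn.eq_or_insert`) until it contains all vertices.

*Surjectivity* (`exists_Psi_eq_of_isLeast`).  Starting from bare roots, the first unexplored leaf is
repeatedly given the children that `x` prescribes.  The keys of the old vertices do not change, and
the new vertices come after the one just explored (`IsDecoding.exists_insert`).  The steps of `x` do
not run out, because the length of `x` is a solution (`IsDecoding.card_ofType_lt`).  When no leaf is
left, the numbers of explored vertices form a solution, which is the length of `x` by minimality.
-/

/-! ### Lists and sorting -/

theorem exists_list_getElem?_eq {α : Type*} (h : ℕ → Option α) (hfin : {k | h k ≠ none}.Finite)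
    (hleft : ∀ k, h (k + 1) ≠ none → h k ≠ none) : ∃ l : List α, ∀ k, l[k]? = h k := by
  classical
  have hex : ∃ n, h n = none := by
    obtain ⟨n, hn⟩ := hfin.exists_notMem
    exact ⟨n, by simpa using hn⟩
  have hge : ∀ k, Nat.find hex ≤ k → h k = none := by
    intro k hk
    induction k, hk using Nat.le_induction with
    | base => exact Nat.find_spec hex
    | succ k _ ih => exact by_contra fun hne => hleft k hne ih
  have hlt : ∀ k : Fin (Nat.find hex), (h k).isSome := fun k =>
    Option.isSome_iff_ne_none.2 (Nat.find_min hex k.2)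
  refine ⟨List.ofFn fun k : Fin (Nat.find hex) => (h k).get (hlt k), fun k => ?_⟩
  rw [List.getElem?_ofFn]
  split_ifs with hk
  · simp
  · exact (hge k (not_lt.1 hk)).symm

theorem finite_setOf_getElem?_eq_some {α : Type*} (l : List α) (a : α) :
    {k : ℕ | l[k]? = some a}.Finite :=
  (Set.finite_lt_nat l.length).subset fun _ hk => (List.getElem?_eq_some_iff.1 hk).1

theorem ncard_setOf_getElem?_eq_some {α : Type*} [DecidableEq α] (l : List α) (a : α) :
    {k : ℕ | l[k]? = some a}.ncard = l.count a := by
  induction l with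
  | nil => simp
  | cons b l ih =>
    have himg : (Nat.succ '' {k : ℕ | l[k]? = some a}).ncard = l.count a := by
      rw [Set.ncard_image_of_injective _ Nat.succ_injective, ih]
    by_cases hba : b = a
    · have hset : {k : ℕ | (b :: l)[k]? = some a} =
          insert 0 (Nat.succ '' {k : ℕ | l[k]? = some a}) := by
        ext k
        cases k <;> simp [hba]
      rw [hset, Set.ncard_insert_of_notMem (by simp)
        ((finite_setOf_getElem?_eq_some l a).image _), himg, hba, List.count_cons_self]
    · have hset : {k : ℕ | (b :: l)[k]? = some a} = Nat.succ '' {k : ℕ | l[k]? = some a} := by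
        ext k
        cases k <;> simp [hba]
      rw [hset, himg, List.count_cons_of_ne hba]

theorem exists_sorted_list_count {d : ℕ} (p : Fin d → ℕ) :
    ∃ l : List (Fin d), l.Pairwise (· ≤ ·) ∧ ∀ j, l.count j = p j := by
  refine ⟨(∑ i, Multiset.replicate (p i) i).sort (· ≤ ·), Multiset.pairwise_sort _ _, fun j => ?_⟩
  rw [← Multiset.coe_count, Multiset.sort_eq, Multiset.count_sum']
  simp [Multiset.count_replicate]

namespace TypedForest

variable {d : ℕ} (f : TypedForest d)

/-! ### The exploration order -/

/-- The set of all vertices. -/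
noncomputable def verts : Finset (List ℕ) := f.finite_verts.toFinset

@[simp]
theorem mem_verts {u : List ℕ} : u ∈ f.verts ↔ f.typ u ≠ none := by
  simp [verts]

@[simp]
theorem mem_typeVerts {i : Fin d} {u : List ℕ} : u ∈ f.typeVerts i ↔ f.typ u = some i := by
  simp [typeVerts]

theorem ne_nil_of_typ_ne_none {u : List ℕ} (hu : f.typ u ≠ none) : u ≠ [] := by
  rintro rfl
  exact hu f.typ_nil

theorem subtreeRoot_suffix (u : List ℕ) : f.subtreeRoot u <:+ u := by
  induction u with
  | nil => exact List.suffix_rfl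
  | cons k u ih =>
    unfold subtreeRoot
    split_ifs
    · exact ih.trans (List.suffix_cons k u)
    · exact List.suffix_rfl

theorem subtreeRoot_ne_nil {u : List ℕ} (hu : f.typ u ≠ none) : f.subtreeRoot u ≠ [] := by
  induction u with
  | nil => exact absurd f.typ_nil hu
  | cons k u ih =>
    unfold subtreeRoot
    split_ifs with h
    · exact ih (h ▸ hu)
    · exact List.cons_ne_nil k u

theorem bfsKey_lt_cons {k : ℕ} {u w : List ℕ} (hw : w ≠ []) (hwu : w <:+ u) :
    bfsKey w < bfsKey (k :: u) := by
  obtain ⟨t, rfl⟩ := hwu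
  have hlast : (k :: (t ++ w)).getLastD 0 = w.getLastD 0 := by
    rw [List.getLastD_eq_getLast?, List.getLastD_eq_getLast?, ← List.cons_append,
      List.getLast?_append_of_ne_nil _ hw]
  unfold bfsKey
  rw [hlast]
  refine Prod.Lex.toLex_lt_toLex.2 (Or.inr ⟨rfl, Prod.Lex.toLex_lt_toLex.2 (Or.inl ?_)⟩)
  simp

/-- The order by `subforestKey`, taken on all vertices at once, explores a vertex before its
children. -/
theorem subforestKey_lt_cons {k : ℕ} {u : List ℕ} (hu : f.typ u ≠ none) :
    f.subforestKey u < f.subforestKey (k :: u) := by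
  by_cases h : f.typ u = f.typ (k :: u)
  · have hroot : f.subtreeRoot (k :: u) = f.subtreeRoot u := by
      rw [subtreeRoot, if_pos h]
    unfold subforestKey
    rw [hroot]
    exact Prod.Lex.toLex_lt_toLex.2
      (Or.inr ⟨rfl, bfsKey_lt_cons (f.ne_nil_of_typ_ne_none hu) List.suffix_rfl⟩)
  · have hroot : f.subtreeRoot (k :: u) = k :: u := by
      rw [subtreeRoot, if_neg h]
    unfold subforestKey
    rw [hroot]
    exact Prod.Lex.toLex_lt_toLex.2
      (Or.inl (bfsKey_lt_cons (f.subtreeRoot_ne_nil hu) (f.subtreeRoot_suffix u)))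

variable {f} in
/-- The place of a vertex in the order depends only on its type and those of its ancestors. -/
theorem subforestKey_congr {g : TypedForest d} {u : List ℕ}
    (h : ∀ w, w <:+ u → f.typ w = g.typ w) : f.subforestKey u = g.subforestKey u := by
  have hroot : f.subtreeRoot u = g.subtreeRoot u := by
    induction u with
    | nil => rfl
    | cons k u ih =>
      unfold subtreeRoot
      rw [h _ List.suffix_rfl, h _ (List.suffix_cons k u),
        ih fun w hw => h w (hw.trans (List.suffix_cons k u))]
  unfold subforestKey
  rw [hroot]

theorem typ_ne_none_of_suffix {u w : List ℕ} (hu : f.typ u ≠ none) (hw : w <:+ u) (hw0 : w ≠ []) :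
    f.typ w ≠ none := by
  induction u with
  | nil => exact absurd f.typ_nil hu
  | cons k u ih =>
    rcases List.suffix_cons_iff.1 hw with rfl | hwu
    · exact hu
    · have hu0 : u ≠ [] := by
        rintro rfl
        exact hw0 (List.suffix_nil.1 hwu)
      exact ih (f.parent_mem u k hu0 hu) hwu

/-- `A` is an initial segment of the set of vertices `S` in the exploration order. -/
def IsInitial (A S : Finset (List ℕ)) : Prop :=
  A ⊆ S ∧ ∀ u ∈ A, ∀ v ∈ S, v ∉ A → f.subforestKey u < f.subforestKey v

theorem exists_first_notMem {A S : Finset (List ℕ)} (h : ¬ S ⊆ A) :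
    ∃ v ∈ S, v ∉ A ∧ ∀ u ∈ S, u ∉ A → f.subforestKey v ≤ f.subforestKey u := by
  obtain ⟨w, hwS, hwA⟩ := Finset.not_subset.1 h
  obtain ⟨v, hv, hmin⟩ := Finset.exists_min_image (S \ A) f.subforestKey
    ⟨w, Finset.mem_sdiff.2 ⟨hwS, hwA⟩⟩
  rw [Finset.mem_sdiff] at hv
  exact ⟨v, hv.1, hv.2, fun u huS huA => hmin u (Finset.mem_sdiff.2 ⟨huS, huA⟩)⟩

variable {f} in
theorem IsInitial.insert_first {A S : Finset (List ℕ)} {v : List ℕ} (hA : f.IsInitial A S)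
    (hvS : v ∈ S) (hv : ∀ u ∈ S, u ∉ A → f.subforestKey v ≤ f.subforestKey u) :
    f.IsInitial (insert v A) S := by
  refine ⟨Finset.insert_subset hvS hA.1, fun u hu w hwS hw => ?_⟩
  rw [Finset.mem_insert, not_or] at hw
  rcases Finset.mem_insert.1 hu with rfl | hu
  · exact lt_of_le_of_ne (hv w hwS hw.2) fun h => hw.1 (f.subforestKey_injective h).symm
  · exact hA.2 u hu w hwS hw.2

theorem subforestList_eq_append {i : Fin d} {A : Finset (List ℕ)}
    (hA : f.IsInitial A (f.typeVerts i)) :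
    f.subforestList i = A.sort f.SubforestLE ++ (f.typeVerts i \ A).sort f.SubforestLE := by
  unfold subforestList
  refine List.Perm.eq_of_pairwise (le := f.SubforestLE)
    (fun a b _ _ h h' => antisymm h h') (Finset.pairwise_sort _ _) ?_ ?_
  · refine List.pairwise_append.2 ⟨Finset.pairwise_sort _ _, Finset.pairwise_sort _ _, ?_⟩
    intro a ha b hb
    rw [Finset.mem_sort] at ha hb
    exact (hA.2 a ha b (Finset.mem_sdiff.1 hb).1 (Finset.mem_sdiff.1 hb).2).le
  · refine (List.perm_ext_iff_of_nodup (Finset.sort_nodup _ _) ?_).2 fun a => ?_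
    · refine List.Nodup.append (Finset.sort_nodup _ _) (Finset.sort_nodup _ _) ?_
      intro a ha hb
      rw [Finset.mem_sort] at ha hb
      exact (Finset.mem_sdiff.1 hb).2 ha
    · simp only [List.mem_append, Finset.mem_sort, Finset.mem_sdiff]
      have := @hA.1 a
      tauto

theorem sum_take_subforestList {i : Fin d} {A : Finset (List ℕ)}
    (hA : f.IsInitial A (f.typeVerts i)) (φ : List ℕ → ℤ) :
    (((f.subforestList i).take A.card).map φ).sum = ∑ u ∈ A, φ u := by
  rw [f.subforestList_eq_append hA, List.take_left' (Finset.length_sort _),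
    ← List.sum_toFinset _ (Finset.sort_nodup _ _), Finset.sort_toFinset]

theorem length_subforestList (i : Fin d) : (f.subforestList i).length = (f.typeVerts i).card :=
  Finset.length_sort _

theorem nodup_subforestList (i : Fin d) : (f.subforestList i).Nodup :=
  Finset.sort_nodup _ _

theorem card_take_subforestList {i : Fin d} {k : ℕ} (hk : k ≤ (f.subforestList i).length) :
    ((f.subforestList i).take k).toFinset.card = k := by
  rw [List.toFinset_card_of_nodup ((f.nodup_subforestList i).sublist (List.take_sublist _ _)),
    List.length_take, min_eq_left hk]

theorem isInitial_take_subforestList (i : Fin d) (k : ℕ) :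
    f.IsInitial ((f.subforestList i).take k).toFinset (f.typeVerts i) := by
  refine ⟨fun u hu => ?_, fun u hu v hv hvA => ?_⟩
  · exact (Finset.mem_sort _).1 (List.mem_of_mem_take (List.mem_toFinset.1 hu))
  · have hsort : (f.subforestList i).Pairwise f.SubforestLE := Finset.pairwise_sort _ _
    rw [← List.take_append_drop k (f.subforestList i), List.pairwise_append] at hsort
    have hv' : v ∈ f.subforestList i := (Finset.mem_sort _).2 hv
    rw [← List.take_append_drop k (f.subforestList i), List.mem_append] at hv'
    rw [List.mem_toFinset] at hu hvA
    refine lt_of_le_of_ne (hsort.2.2 u hu v (hv'.resolve_left hvA)) fun h => hvA ?_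
    rwa [← f.subforestKey_injective h]

/-! ### Children and roots -/

theorem finite_children (u : List ℕ) : {k | f.typ (k :: u) ≠ none}.Finite :=
  f.finite_verts.preimage fun _ _ _ _ h => (List.cons.inj h).1

/-- The types of the children of a vertex, or of the roots when `u = []`, form a list. -/
theorem exists_childTypes (u : List ℕ) :
    ∃ l : List (Fin d), (∀ k : ℕ, l[k]? = f.typ (k :: u)) ∧ ∀ j, l.count j = f.numChildren j u := by
  obtain ⟨l, hl⟩ := exists_list_getElem?_eq (fun k => f.typ (k :: u)) (f.finite_children u)
    (f.left_mem u)
  refine ⟨l, hl, fun j => ?_⟩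
  rw [← ncard_setOf_getElem?_eq_some]
  simp only [hl, numChildren]

theorem getElem?_rootTypes (a : ℕ) : f.rootTypes[a]? = f.typ [a] := by
  obtain ⟨l, hl, -⟩ := f.exists_childTypes []
  have hnum : f.numTrees = l.length := by
    unfold numTrees
    simp only [← hl, ne_eq, List.getElem?_eq_none_iff, not_le]
    exact (Set.ncard_eq_toFinset_card' _).trans (by simp)
  have hroot : f.rootTypes = l := by
    unfold rootTypes
    rw [hnum]
    simp only [← hl]
    have : (List.range l.length).map (fun a => l[a]?) = l.map some := by
      refine List.ext_getElem (by simp) fun k h1 h2 => ?_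
      simp at h1
      simp [h1]
    calc (List.range l.length).filterMap (fun a => l[a]?)
        = ((List.range l.length).map fun a => l[a]?).filterMap id := by
          rw [List.filterMap_map, Function.id_comp]
      _ = l := by rw [this, List.filterMap_map, Function.id_comp, List.filterMap_some]
  rw [hroot, hl]

theorem length_rootTypes : f.rootTypes.length = f.numTrees := by
  unfold numTrees
  simp only [← getElem?_rootTypes, ne_eq, List.getElem?_eq_none_iff, not_le]
  exact ((Set.ncard_eq_toFinset_card' _).trans (by simp)).symm

theorem numChildren_nil (j : Fin d) : f.numChildren j [] = f.rootTypes.count j := by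
  rw [← ncard_setOf_getElem?_eq_some]
  simp only [getElem?_rootTypes, numChildren]

variable {f} in
/-- Children are sorted by type, so their numbers determine their types. -/
theorem typ_cons_eq_of_numChildren_eq {g : TypedForest d} {u : List ℕ} (hu : u ≠ [])
    (h : ∀ j, f.numChildren j u = g.numChildren j u) (k : ℕ) : f.typ (k :: u) = g.typ (k :: u) := by
  have key : ∀ (f : TypedForest d) (l : List (Fin d)), (∀ k : ℕ, l[k]? = f.typ (k :: u)) →
      l.Pairwise (· ≤ ·) := by
    intro f l hl
    refine List.pairwise_iff_getElem.2 fun a b ha hb hab => ?_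
    exact f.sorted u a b _ _ hu hab.le (by rw [← hl, List.getElem?_eq_getElem ha])
      (by rw [← hl, List.getElem?_eq_getElem hb])
  obtain ⟨l, hl, hlc⟩ := f.exists_childTypes u
  obtain ⟨m, hm, hmc⟩ := g.exists_childTypes u
  have hlm : l = m := List.Perm.eq_of_pairwise (fun a b _ _ => le_antisymm)
    (key f l hl) (key g m hm) (List.perm_iff_count.2 fun j => by rw [hlc, hmc, h])
  rw [← hl, ← hm, hlm]

/-! ### Counting the children of a set of vertices -/

/-- The vertices in `A` of type `i`. -/
def ofType (A : Finset (List ℕ)) (i : Fin d) : Finset (List ℕ) :=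
  A.filter fun u => f.typ u = some i

@[simp]
theorem mem_ofType {A : Finset (List ℕ)} {i : Fin d} {u : List ℕ} :
    u ∈ f.ofType A i ↔ u ∈ A ∧ f.typ u = some i :=
  Finset.mem_filter

theorem ofType_verts (i : Fin d) : f.ofType f.verts i = f.typeVerts i := by
  ext u
  rw [mem_ofType, mem_verts, mem_typeVerts]
  exact ⟨And.right, fun h => ⟨by simp [h], h⟩⟩

variable {f} in
theorem IsInitial.ofType {A : Finset (List ℕ)} (hA : f.IsInitial A f.verts) (i : Fin d) :
    f.IsInitial (f.ofType A i) (f.typeVerts i) := by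
  refine ⟨fun u hu => f.mem_typeVerts.2 (f.mem_ofType.1 hu).2, fun u hu v hv hvA => ?_⟩
  rw [mem_typeVerts] at hv
  exact hA.2 u (f.mem_ofType.1 hu).1 v (f.mem_verts.2 (by simp [hv]))
    fun h => hvA (f.mem_ofType.2 ⟨h, hv⟩)

theorem sum_ofType {A : Finset (List ℕ)} (hA : A ⊆ f.verts) (φ : List ℕ → ℤ) :
    ∑ i, ∑ u ∈ f.ofType A i, φ u = ∑ u ∈ A, φ u := by
  simp only [ofType, Finset.sum_filter]
  rw [Finset.sum_comm]
  refine Finset.sum_congr rfl fun u hu => ?_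
  obtain ⟨i, hi⟩ := Option.ne_none_iff_exists'.1 (f.mem_verts.1 (hA hu))
  simp [hi]

/-- The vertices of type `j` that are roots or children of vertices in `A`.  A root has tail `[]`,
which is not a vertex. -/
noncomputable def reached (A : Finset (List ℕ)) (j : Fin d) : Finset (List ℕ) :=
  (f.typeVerts j).filter fun u => u.tail ∈ insert [] A

theorem card_filter_tail (j : Fin d) (u : List ℕ) :
    ((f.typeVerts j).filter fun w => w.tail = u).card = f.numChildren j u := by
  unfold numChildren
  rw [← Set.ncard_image_of_injective (f := fun k => k :: u) _ fun _ _ h => (List.cons.inj h).1,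
    ← Set.ncard_coe_finset]
  congr 1
  ext w
  cases w with
  | nil => simp [f.typ_nil]
  | cons k w =>
    simp only [Finset.coe_filter, mem_typeVerts, List.tail_cons, Set.mem_ofPred_eq, Set.mem_image,
      List.cons.injEq]
    constructor
    · rintro ⟨h, rfl⟩
      exact ⟨k, h, rfl, rfl⟩
    · rintro ⟨_, h, rfl, rfl⟩
      exact ⟨h, rfl⟩

theorem card_reached {A : Finset (List ℕ)} (hA : A ⊆ f.verts) (j : Fin d) :
    (f.reached A j).card = f.rootTypes.count j + ∑ u ∈ A, f.numChildren j u := by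
  have hnil : [] ∉ A := fun h => f.mem_verts.1 (hA h) f.typ_nil
  have hmaps : ∀ u ∈ f.reached A j, u.tail ∈ insert [] A := fun u hu => (Finset.mem_filter.1 hu).2
  rw [← numChildren_nil, ← Finset.sum_insert hnil, Finset.card_eq_sum_card_fiberwise hmaps]
  refine Finset.sum_congr rfl fun u hu => ?_
  rw [← card_filter_tail, reached, Finset.filter_filter]
  congr 1
  refine Finset.filter_congr fun w _ => ?_
  constructor
  · exact And.right
  · rintro rfl
    exact ⟨hu, rfl⟩

/-- The value of the system at `A`: the number of type `j` vertices reached from `A`, minus the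
number of those in `A`. -/
theorem count_rootTypes_add_sum_step {A : Finset (List ℕ)} (hA : A ⊆ f.verts) (j : Fin d) :
    (f.rootTypes.count j : ℤ) + ∑ i, ∑ u ∈ f.ofType A i, f.step i j u =
      (f.reached A j).card - (f.ofType A j).card := by
  rw [f.card_reached hA]
  push_cast
  rw [← f.sum_ofType hA]
  simp only [step, Finset.sum_sub_distrib, Finset.sum_const, nsmul_eq_mul, mul_ite, mul_one,
    mul_zero, Finset.sum_ite_eq', Finset.mem_univ, if_true]
  ring

/-- A proper subset of the vertices that is initial in each type reaches a vertex outside it: the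
first vertex `v` outside, in the order on all vertices, is a root or has its parent in the set, and
the same holds for all vertices of the set of the same type as `v`. -/
theorem eq_verts_of_card_reached_le {A : Finset (List ℕ)} (hA : A ⊆ f.verts)
    (hinit : ∀ i, f.IsInitial (f.ofType A i) (f.typeVerts i))
    (hcard : ∀ j, (f.reached A j).card ≤ (f.ofType A j).card) : A = f.verts := by
  refine hA.antisymm ?_
  by_contra hne
  obtain ⟨v, hv, hvA, hmin⟩ := f.exists_first_notMem hne
  obtain ⟨j, hj⟩ := Option.ne_none_iff_exists'.1 (f.mem_verts.1 hv)
  have hvj : v ∉ f.ofType A j := fun h => hvA (f.mem_ofType.1 h).1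
  have hsub : insert v (f.ofType A j) ⊆ f.reached A j := by
    intro u hu
    have huj : f.typ u = some j ∧ f.subforestKey u ≤ f.subforestKey v := by
      rcases Finset.mem_insert.1 hu with rfl | hu
      · exact ⟨hj, le_rfl⟩
      · exact ⟨(f.mem_ofType.1 hu).2, ((hinit j).2 u hu v (f.mem_typeVerts.2 hj) hvj).le⟩
    refine Finset.mem_filter.2 ⟨f.mem_typeVerts.2 huj.1, Finset.mem_insert.2 ?_⟩
    cases u with
    | nil => exact Or.inl rfl
    | cons k w =>
      refine or_iff_not_imp_left.2 fun hw => ?_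
      have hw' : f.typ w ≠ none := f.parent_mem w k hw (by simp [huj.1])
      by_contra hwA
      exact absurd ((f.subforestKey_lt_cons hw').trans_le huj.2)
        (not_lt.2 (hmin w (f.mem_verts.2 hw') hwA))
  have := Finset.card_le_card hsub
  rw [Finset.card_insert_of_notMem hvj] at this
  have := hcard j
  omega

end TypedForest

namespace CodingSeq

variable {d : ℕ}

/-! ### Coding sequences with natural number times -/

/-- The value at time `k` of the `j`-th coordinate of the `i`-th chain, set to `0` for `k` beyond
the length. -/
def valAt (x : CodingSeq d) (i : Fin d) (k : ℕ) (j : Fin d) : ℤ :=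
  if h : k < x.len i + 1 then x.val i ⟨k, h⟩ j else 0

theorem valAt_val (x : CodingSeq d) (i : Fin d) (k : Fin (x.len i + 1)) (j : Fin d) :
    x.valAt i k j = x.val i k j :=
  dif_pos k.2

theorem valAt_zero (x : CodingSeq d) (i j : Fin d) : x.valAt i 0 j = 0 := by
  have := x.valAt_val i 0 j
  rwa [x.val_zero, Fin.val_zero] at this

theorem valAt_mono (x : CodingSeq d) {i j : Fin d} (hij : i ≠ j) {k l : ℕ} (hkl : k ≤ l)
    (hl : l ≤ x.len i) : x.valAt i k j ≤ x.valAt i l j := by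
  rw [valAt, valAt, dif_pos (by omega), dif_pos (by omega)]
  exact x.mono i j hij (Fin.mk_le_mk.2 hkl)

theorem valAt_step (x : CodingSeq d) (i j : Fin d) {k : ℕ} (hk : k < x.len i) :
    0 ≤ x.valAt i (k + 1) j - x.valAt i k j + if i = j then 1 else 0 := by
  by_cases hij : i = j
  · subst hij
    have := x.skip_free i ⟨k, hk⟩
    rw [valAt, valAt, dif_pos (by omega), dif_pos (by omega), if_pos rfl]
    simp only [Fin.succ_mk, Fin.castSucc_mk] at this
    linarith
  · have := x.valAt_mono hij (Nat.le_succ k) hk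
    rw [if_neg hij]
    simpa using this

theorem ext_valAt {x y : CodingSeq d} (hlen : ∀ i, x.len i = y.len i)
    (hval : ∀ i, ∀ k ≤ x.len i, ∀ j, x.valAt i k j = y.valAt i k j) : x = y := by
  cases x with | mk n v _ _ _ =>
  cases y with | mk m w _ _ _ =>
  obtain rfl : n = m := funext hlen
  obtain rfl : v = w := by
    funext i k j
    have := hval i k (Nat.lt_succ_iff.1 k.2) j
    rwa [valAt_val, valAt_val] at this
  rfl

end CodingSeq

namespace TypedForest

variable {d : ℕ} (f : TypedForest d)

/-! ### The coding of a forest -/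

/-- The chain of type `i`, at the size of an initial segment of the subforest of type `i`, is the
sum of the steps over the segment. -/
theorem Psi_valAt {i : Fin d} {A : Finset (List ℕ)} (hA : f.IsInitial A (f.typeVerts i))
    (j : Fin d) : f.Psi.valAt i A.card j = ∑ u ∈ A, f.step i j u := by
  have hlt : A.card < f.Psi.len i + 1 :=
    Nat.lt_succ_iff.2 ((Finset.card_le_card hA.1).trans_eq (f.length_subforestList i).symm)
  rw [CodingSeq.valAt, dif_pos hlt]
  exact f.sum_take_subforestList hA _

/-- The length vector of the coding of a forest is the smallest solution of its system. -/
theorem isLeast_len_Psi {r : Fin d → ℕ} (hr : ∀ i, f.rootTypes.count i = r i) :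
    IsLeast {s | f.Psi.IsSolution r s} fun i => Fin.last (f.Psi.len i) := by
  constructor
  · intro j
    have hbal := f.count_rootTypes_add_sum_step subset_rfl j
    have hreach : f.reached f.verts j = f.typeVerts j := by
      refine Finset.filter_true_of_mem fun u hu => Finset.mem_insert.2 ?_
      rw [mem_typeVerts] at hu
      cases u with
      | nil => exact Or.inl rfl
      | cons k w =>
        exact or_iff_not_imp_left.2 fun hw => f.mem_verts.2 (f.parent_mem w k hw (by simp [hu]))
    rw [hreach, ofType_verts, sub_self, hr] at hbal
    rw [← hbal]
    congr 1
    refine Finset.sum_congr rfl fun i _ => ?_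
    have hfull : f.IsInitial (f.typeVerts i) (f.typeVerts i) :=
      ⟨subset_rfl, fun _ _ v hv hv' => absurd hv hv'⟩
    rw [ofType_verts, ← f.Psi_valAt hfull, ← length_subforestList, ← CodingSeq.valAt_val]
    rfl
  · intro s hs i
    have hle : ∀ i, (s i : ℕ) ≤ (f.subforestList i).length := fun i => Nat.lt_succ_iff.1 (s i).2
    let B : Fin d → Finset (List ℕ) := fun i => ((f.subforestList i).take (s i)).toFinset
    have hB : ∀ i, f.IsInitial (B i) (f.typeVerts i) := fun i =>
      f.isInitial_take_subforestList i (s i)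
    have hBcard : ∀ i, (B i).card = s i := fun i => f.card_take_subforestList (hle i)
    let A : Finset (List ℕ) := Finset.univ.biUnion B
    have hAB : ∀ i, f.ofType A i = B i := by
      intro i
      ext u
      rw [mem_ofType, Finset.mem_biUnion]
      constructor
      · rintro ⟨⟨j, -, hj⟩, hi⟩
        have hj' := f.mem_typeVerts.1 ((hB j).1 hj)
        rw [hi, Option.some_inj] at hj'
        rwa [hj']
      · exact fun hu => ⟨⟨i, Finset.mem_univ i, hu⟩, f.mem_typeVerts.1 ((hB i).1 hu)⟩
    have hA : A ⊆ f.verts := by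
      refine Finset.biUnion_subset.2 fun i _ u hu => f.mem_verts.2 ?_
      simp [f.mem_typeVerts.1 ((hB i).1 hu)]
    have hall : A = f.verts := by
      refine f.eq_verts_of_card_reached_le hA (fun i => (hAB i).symm ▸ hB i) fun j => ?_
      have hbal := f.count_rootTypes_add_sum_step hA j
      have hsol := hs j
      have hsum : ∑ i, ∑ u ∈ f.ofType A i, f.step i j u = ∑ i, f.Psi.val i (s i) j := by
        refine Finset.sum_congr rfl fun i _ => ?_
        rw [hAB, ← f.Psi_valAt (hB i), hBcard, CodingSeq.valAt_val]
      rw [hsum, hr, hsol] at hbal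
      omega
    have hcard : (s i : ℕ) = (f.subforestList i).length := by
      rw [← hBcard, ← hAB, hall, ofType_verts, length_subforestList]
    exact Fin.le_def.2 hcard.ge

end TypedForest

namespace TypedForest

variable {d : ℕ}

/-! ### Injectivity -/

/-- `A` is a common initial segment of `f` and `g`, on which they agree: the roots have the same
types, and so do the children of the vertices of `A`. -/
structure AgreeOn (f g : TypedForest d) (A : Finset (List ℕ)) : Prop where
  left : f.IsInitial A f.verts
  right : g.IsInitial A g.verts
  typ_eq : ∀ u, u.tail ∈ insert [] A → f.typ u = g.typ u

variable {f g : TypedForest d} {A : Finset (List ℕ)}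

theorem AgreeOn.symm (h : AgreeOn f g A) : AgreeOn g f A :=
  ⟨h.right, h.left, fun u hu => (h.typ_eq u hu).symm⟩

/-- The first vertex outside `A` is a root or has its parent in `A`. -/
theorem parent_mem_of_first {k : ℕ} {w : List ℕ} (hu : f.typ (k :: w) ≠ none)
    (hkw : ∀ u ∈ f.verts, u ∉ A → f.subforestKey (k :: w) ≤ f.subforestKey u) :
    w ∈ insert [] A := by
  by_contra hw
  rw [Finset.mem_insert, not_or] at hw
  have hw' := f.parent_mem w k hw.1 hu
  exact absurd (f.subforestKey_lt_cons hw') (not_lt.2 (hkw w (f.mem_verts.2 hw') hw.2))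

theorem IsInitial.parent_mem_of_mem {k : ℕ} {w : List ℕ} (hA : f.IsInitial A f.verts)
    (hu : k :: w ∈ A) : w ∈ insert [] A :=
  parent_mem_of_first (f.mem_verts.1 (hA.1 hu)) fun v hv hvA => (hA.2 _ hu v hv hvA).le

theorem AgreeOn.typ_eq_of_suffix (h : AgreeOn f g A) {u w : List ℕ} (hu : u.tail ∈ insert [] A)
    (hw : w <:+ u) : f.typ w = g.typ w := by
  induction u with
  | nil => rw [List.suffix_nil.1 hw, f.typ_nil, g.typ_nil]
  | cons k v ih =>
    rcases List.suffix_cons_iff.1 hw with rfl | hwv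
    · exact h.typ_eq _ hu
    · refine ih ?_ hwv
      cases v with
      | nil => exact Finset.mem_insert_self _ _
      | cons l v => exact h.left.parent_mem_of_mem ((Finset.mem_insert.1 hu).resolve_left (by simp))

/-- The first vertex of `f` outside `A` is one of `g`, with the same place in its order. -/
theorem AgreeOn.first_notMem (h : AgreeOn f g A) {v : List ℕ} (hv : v ∈ f.verts)
    (hmin : ∀ u ∈ f.verts, u ∉ A → f.subforestKey v ≤ f.subforestKey u) :
    v ∈ g.verts ∧ f.typ v = g.typ v ∧ f.subforestKey v = g.subforestKey v := by
  rw [mem_verts] at hv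
  have htail : v.tail ∈ insert [] A := by
    cases v with
    | nil => exact absurd f.typ_nil hv
    | cons k w => exact parent_mem_of_first hv hmin
  have htyp := h.typ_eq v htail
  exact ⟨g.mem_verts.2 (htyp ▸ hv), htyp,
    subforestKey_congr fun w hw => h.typ_eq_of_suffix htail hw⟩

theorem AgreeOn.ofType_eq (h : AgreeOn f g A) (i : Fin d) : f.ofType A i = g.ofType A i := by
  refine Finset.filter_congr fun u hu => ?_
  rw [h.typ_eq u]
  cases u with
  | nil => exact Finset.mem_insert_self _ _
  | cons k w => exact h.left.parent_mem_of_mem hu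

/-- The step at the next vertex `v` is an increment of the coding. -/
theorem step_eq_sub (hA : f.IsInitial A f.verts) {v : List ℕ} (hvA : v ∉ A)
    (hmin : ∀ u ∈ f.verts, u ∉ A → f.subforestKey v ≤ f.subforestKey u) {i : Fin d}
    (hi : f.typ v = some i) (j : Fin d) : f.step i j v =
      f.Psi.valAt i ((f.ofType A i).card + 1) j - f.Psi.valAt i (f.ofType A i).card j := by
  have hv : v ∈ f.verts := f.mem_verts.2 (by simp [hi])
  have hvi : v ∉ f.ofType A i := fun h => hvA (f.mem_ofType.1 h).1
  have hins : f.ofType (insert v A) i = insert v (f.ofType A i) := by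
    rw [ofType, Finset.filter_insert, if_pos hi, ofType]
  have hinit := (hA.insert_first hv hmin).ofType i
  rw [hins] at hinit
  have h1 := f.Psi_valAt hinit j
  rw [Finset.card_insert_of_notMem hvi, Finset.sum_insert hvi] at h1
  rw [h1, f.Psi_valAt (hA.ofType i) j, add_sub_cancel_right]

theorem AgreeOn.verts_subset (h : AgreeOn f g f.verts) : g.verts ⊆ f.verts := by
  by_contra hne
  obtain ⟨v, hv, hvA, hmin⟩ := g.exists_first_notMem hne
  exact hvA (h.symm.first_notMem hv hmin).1

theorem AgreeOn.eq_or_insert (hPsi : f.Psi = g.Psi) (h : AgreeOn f g A) :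
    f = g ∨ ∃ v ∉ A, AgreeOn f g (insert v A) := by
  by_cases hsub : f.verts ⊆ A
  · left
    obtain rfl : f.verts = A := hsub.antisymm h.left.1
    have hverts : f.verts = g.verts := h.right.1.antisymm h.verts_subset
    ext1
    funext u
    by_cases hu : u ∈ f.verts
    · refine h.typ_eq u ?_
      cases u with
      | nil => exact Finset.mem_insert_self _ _
      | cons k w => exact h.left.parent_mem_of_mem hu
    · have hu' := hu
      rw [hverts] at hu'
      rw [mem_verts, not_not] at hu hu'
      rw [hu, hu']
  · right
    obtain ⟨v, hv, hvA, hmin⟩ := f.exists_first_notMem hsub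
    obtain ⟨hvg, htyp, hkey⟩ := h.first_notMem hv hmin
    have hming : ∀ u ∈ g.verts, u ∉ A → g.subforestKey v ≤ g.subforestKey u := by
      obtain ⟨w, hw, hwA, hwmin⟩ := g.exists_first_notMem fun hs => hvA (hs hvg)
      obtain ⟨hwf, -, hwkey⟩ := h.symm.first_notMem hw hwmin
      have hle : g.subforestKey v ≤ g.subforestKey w := by
        rw [← hkey, hwkey]
        exact hmin w hwf hwA
      exact fun u hu huA => hle.trans (hwmin u hu huA)
    refine ⟨v, hvA, h.left.insert_first hv hmin, h.right.insert_first hvg hming, fun u hu => ?_⟩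
    rw [Finset.insert_comm, Finset.mem_insert] at hu
    rcases hu with hu | hu
    · obtain ⟨i, hi⟩ := Option.ne_none_iff_exists'.1 (f.mem_verts.1 hv)
      have hnum : ∀ j, f.numChildren j v = g.numChildren j v := by
        intro j
        have h1 := step_eq_sub h.left hvA hmin hi j
        rw [hPsi, h.ofType_eq, ← step_eq_sub h.right hvA hming (htyp ▸ hi) j] at h1
        simpa [step] using h1
      have hv0 := f.ne_nil_of_typ_ne_none (f.mem_verts.1 hv)
      cases u with
      | nil => rw [f.typ_nil, g.typ_nil]
      | cons k w =>
        obtain rfl : w = v := hu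
        exact typ_cons_eq_of_numChildren_eq hv0 hnum k
    · exact h.typ_eq u hu

theorem Phi_injective : Function.Injective (Phi (d := d)) := by
  intro f g hfg
  obtain ⟨hPsi, hroot⟩ : f.Psi = g.Psi ∧ f.rootTypes = g.rootTypes := Prod.mk.inj hfg
  have key : ∀ n : ℕ, f = g ∨ ∃ A : Finset (List ℕ), A.card = n ∧ AgreeOn f g A := by
    intro n
    induction n with
    | zero =>
      refine Or.inr ⟨∅, rfl, ⟨Finset.empty_subset _, by simp⟩, ⟨Finset.empty_subset _, by simp⟩,
        fun u hu => ?_⟩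
      cases u with
      | nil => rw [f.typ_nil, g.typ_nil]
      | cons a w =>
        obtain rfl : w = [] := by simpa using hu
        rw [← getElem?_rootTypes, ← getElem?_rootTypes, hroot]
    | succ n ih =>
      obtain h | ⟨A, hcard, hA⟩ := ih
      · exact Or.inl h
      · refine (hA.eq_or_insert hPsi).imp id ?_
        rintro ⟨v, hv, hvA⟩
        exact ⟨insert v A, by rw [Finset.card_insert_of_notMem hv, hcard], hvA⟩
  obtain h | ⟨A, hcard, hA⟩ := key (f.verts.card + 1)
  · exact h
  · have := Finset.card_le_card hA.left.1
    omega

/-! ### Surjectivity -/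

/-- The forest of the given trees, each reduced to its root. -/
def ofRoots (l : List (Fin d)) : TypedForest d where
  typ
    | [a] => l[a]?
    | _ => none
  typ_nil := rfl
  finite_verts := by
    refine ((Set.finite_lt_nat l.length).image fun a => [a]).subset fun u hu => ?_
    match u, hu with
    | [a], hu => exact ⟨a, by simpa using hu, rfl⟩
  parent_mem u k hu h := by
    match u, hu, h with
    | _ :: _, _, h => exact absurd rfl h
  left_mem u k h := by
    match u, h with
    | [], h =>
      simp only [ne_eq, List.getElem?_eq_none_iff, not_le] at h ⊢
      omega
  sorted u k l i j hu _ h := by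
    match u, hu, h with
    | _ :: _, _, h => exact absurd h (by simp)

/-- The forest obtained by giving the leaf `v` children whose types are listed by `l`. -/
def graft (f : TypedForest d) (v : List ℕ) (hv : f.typ v ≠ none)
    (hleaf : ∀ k, f.typ (k :: v) = none) (l : List (Fin d)) (hl : l.Pairwise (· ≤ ·)) :
    TypedForest d where
  typ
    | [] => none
    | k :: w => if w = v then l[k]? else f.typ (k :: w)
  typ_nil := rfl
  finite_verts := by
    refine (f.finite_verts.union ((Set.finite_lt_nat l.length).image fun k => k :: v)).subset
      fun u hu => ?_
    match u, hu with
    | k :: w, hu =>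
      by_cases hw : w = v
      · simp only [Set.mem_ofPred_eq, hw, if_true] at hu
        exact Or.inr ⟨k, by simpa using hu, by rw [hw]⟩
      · simp only [Set.mem_ofPred_eq, hw, if_false] at hu
        exact Or.inl hu
  parent_mem u k hu h := by
    match u, hu, h with
    | a :: w, _, h =>
      dsimp only at h ⊢
      by_cases hav : a :: w = v
      · have hw : w ≠ v := by
          rintro rfl
          exact List.cons_ne_self a w hav
        rw [if_neg hw, hav]
        exact hv
      · rw [if_neg hav] at h
        have haw := f.parent_mem (a :: w) k (List.cons_ne_nil a w) h
        have hw : w ≠ v := by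
          rintro rfl
          exact haw (hleaf a)
        rwa [if_neg hw]
  left_mem u k h := by
    dsimp only at h ⊢
    split_ifs at h ⊢
    · simp only [ne_eq, List.getElem?_eq_none_iff, not_le] at h ⊢
      omega
    · exact f.left_mem u k h
  sorted u k m i j hu hkm hk hm := by
    dsimp only at hk hm
    split_ifs at hk hm
    · obtain ⟨hk', rfl⟩ := List.getElem?_eq_some_iff.1 hk
      obtain ⟨hm', rfl⟩ := List.getElem?_eq_some_iff.1 hm
      exact hl.rel_get_of_le (a := ⟨k, hk'⟩) (b := ⟨m, hm'⟩) hkm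
    · exact f.sorted u k m i j hu hkm hk hm

section graft

variable {v : List ℕ} {hv : f.typ v ≠ none} {hleaf : ∀ k, f.typ (k :: v) = none}
  {l : List (Fin d)} {hl : l.Pairwise (· ≤ ·)}

theorem graft_typ_cons_self (k : ℕ) : (f.graft v hv hleaf l hl).typ (k :: v) = l[k]? :=
  if_pos rfl

theorem graft_typ_cons {w : List ℕ} (hw : w ≠ v) (k : ℕ) :
    (f.graft v hv hleaf l hl).typ (k :: w) = f.typ (k :: w) :=
  if_neg hw

theorem graft_typ_of_mem {u : List ℕ} (hu : f.typ u ≠ none) :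
    (f.graft v hv hleaf l hl).typ u = f.typ u := by
  cases u with
  | nil => exact absurd f.typ_nil hu
  | cons k w =>
    refine graft_typ_cons ?_ k
    rintro rfl
    exact hu (hleaf k)

theorem graft_subforestKey {u : List ℕ} (hu : f.typ u ≠ none) :
    (f.graft v hv hleaf l hl).subforestKey u = f.subforestKey u := by
  refine subforestKey_congr fun w hw => ?_
  by_cases hw0 : w = []
  · rw [hw0, typ_nil, typ_nil]
  · exact graft_typ_of_mem (f.typ_ne_none_of_suffix hu hw hw0)

theorem graft_mem_verts {u : List ℕ} (hu : u ∈ (f.graft v hv hleaf l hl).verts) :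
    u ∈ f.verts ∨ ∃ k, u = k :: v := by
  rw [mem_verts] at hu
  cases u with
  | nil => exact absurd (typ_nil _) hu
  | cons k w =>
    by_cases hw : w = v
    · exact Or.inr ⟨k, by rw [hw]⟩
    · rw [graft_typ_cons hw] at hu
      exact Or.inl (f.mem_verts.2 hu)

theorem graft_step_self (i j : Fin d) :
    (f.graft v hv hleaf l hl).step i j v = l.count j - if i = j then 1 else 0 := by
  rw [step, numChildren]
  simp only [graft_typ_cons_self, ncard_setOf_getElem?_eq_some]

theorem graft_step {w : List ℕ} (hw : w ≠ v) (i j : Fin d) :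
    (f.graft v hv hleaf l hl).step i j w = f.step i j w := by
  simp only [step, numChildren, graft_typ_cons hw]

theorem graft_rootTypes : (f.graft v hv hleaf l hl).rootTypes = f.rootTypes := by
  refine List.ext_getElem? fun a => ?_
  rw [getElem?_rootTypes, getElem?_rootTypes]
  exact graft_typ_cons (f.ne_nil_of_typ_ne_none hv).symm a

end graft

/-- A stage of the decoding of `(x, c)`: the vertices of `A` have been explored, and given the
children that `x` prescribes; the others are still leaves.  This prescription is given by the
sums of the steps over the initial segments of the explored vertices of each type. -/
structure IsDecoding (x : CodingSeq d) (c : List (Fin d)) (f : TypedForest d)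
    (A : Finset (List ℕ)) : Prop where
  initial : f.IsInitial A f.verts
  leaf : ∀ u ∈ f.verts, u ∉ A → ∀ k, f.typ (k :: u) = none
  roots : f.rootTypes = c
  card_le : ∀ i, (f.ofType A i).card ≤ x.len i
  sum_step : ∀ i j, ∀ B, f.IsInitial B (f.ofType A i) →
    x.valAt i B.card j = ∑ u ∈ B, f.step i j u

variable {x : CodingSeq d} {c : List (Fin d)}

theorem isDecoding_ofRoots : IsDecoding x c (ofRoots c) ∅ where
  initial := ⟨Finset.empty_subset _, by simp⟩
  leaf u hu _ k := by
    match u, hu with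
    | [], hu => exact absurd (typ_nil _) ((mem_verts _).1 hu)
    | _ :: _, _ => exact rfl
  roots := List.ext_getElem? fun a => getElem?_rootTypes _ a
  card_le i := Nat.zero_le _
  sum_step i j B hB := by
    obtain rfl : B = ∅ := Finset.subset_empty.1 hB.1
    exact x.valAt_zero i j

theorem IsInitial.congr {B S : Finset (List ℕ)} (h : g.IsInitial B S)
    (hkey : ∀ u ∈ S, g.subforestKey u = f.subforestKey u) : f.IsInitial B S :=
  ⟨h.1, fun u hu w hw hwB => by
    rw [← hkey u (h.1 hu), ← hkey w hw]
    exact h.2 u hu w hw hwB⟩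

theorem IsDecoding.exists_insert (h : IsDecoding x c f A) {v : List ℕ} (hv : v ∈ f.verts)
    (hvA : v ∉ A) (hmin : ∀ u ∈ f.verts, u ∉ A → f.subforestKey v ≤ f.subforestKey u)
    {i : Fin d} (hi : f.typ v = some i) (hlt : (f.ofType A i).card < x.len i) :
    ∃ g, IsDecoding x c g (insert v A) := by
  obtain ⟨l, hl, hcount⟩ := exists_sorted_list_count fun j =>
    (x.valAt i ((f.ofType A i).card + 1) j - x.valAt i (f.ofType A i).card j +
      if i = j then 1 else 0).toNat
  have hv' := f.mem_verts.1 hv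
  have hleaf := h.leaf v hv hvA
  have hins := h.initial.insert_first hv hmin
  have hstep : ∀ j, (f.graft v hv' hleaf l hl).step i j v =
      x.valAt i ((f.ofType A i).card + 1) j - x.valAt i (f.ofType A i).card j := by
    intro j
    rw [graft_step_self, hcount, Int.toNat_of_nonneg (x.valAt_step i j hlt), add_sub_cancel_right]
  have htyp : ∀ u ∈ f.verts, (f.graft v hv' hleaf l hl).typ u = f.typ u := fun u hu =>
    graft_typ_of_mem (f.mem_verts.1 hu)
  have hkey : ∀ u ∈ f.verts, (f.graft v hv' hleaf l hl).subforestKey u = f.subforestKey u :=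
    fun u hu => graft_subforestKey (f.mem_verts.1 hu)
  have hchild : ∀ w ≠ v, ∀ k, (f.graft v hv' hleaf l hl).typ (k :: w) = f.typ (k :: w) :=
    fun w hw k => graft_typ_cons hw k
  have hstep' : ∀ w ≠ v, ∀ i j, (f.graft v hv' hleaf l hl).step i j w = f.step i j w :=
    fun w hw i j => graft_step hw i j
  have hverts : ∀ u ∈ (f.graft v hv' hleaf l hl).verts, u ∈ f.verts ∨ ∃ k, u = k :: v :=
    fun u hu => graft_mem_verts hu
  have hroots : (f.graft v hv' hleaf l hl).rootTypes = f.rootTypes := graft_rootTypes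
  generalize f.graft v hv' hleaf l hl = g at *
  have hof : ∀ i', g.ofType (insert v A) i' = f.ofType (insert v A) i' := fun i' =>
    Finset.filter_congr fun u hu => by rw [htyp u (hins.1 hu)]
  have hofi : f.ofType (insert v A) i = insert v (f.ofType A i) := by
    rw [ofType, Finset.filter_insert, if_pos hi, ofType]
  have hofne : ∀ i' ≠ i, f.ofType (insert v A) i' = f.ofType A i' := fun i' hne => by
    rw [ofType, Finset.filter_insert, if_neg, ofType]
    rw [hi, Option.some_inj]
    exact hne.symm
  have hvi : v ∉ f.ofType A i := fun hmem => hvA (f.mem_ofType.1 hmem).1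
  -- the sums over segments that do not contain `v` are unchanged
  have hold : ∀ i' j, ∀ B, f.IsInitial B (f.ofType A i') →
      x.valAt i' B.card j = ∑ u ∈ B, g.step i' j u := by
    intro i' j B hB
    rw [h.sum_step i' j B hB]
    refine Finset.sum_congr rfl fun u hu => (hstep' u ?_ i' j).symm
    rintro rfl
    exact hvA (f.mem_ofType.1 (hB.1 hu)).1
  refine ⟨g, ⟨fun u hu => ?_, fun u hu w hw hwA => ?_⟩, fun u hu huA k => ?_,
    hroots.trans h.roots, fun i' => ?_, fun i' j B hB => ?_⟩
  · have huf := hins.1 hu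
    rw [mem_verts, htyp u huf]
    exact f.mem_verts.1 huf
  · rw [hkey u (hins.1 hu)]
    rcases hverts w hw with hwf | ⟨k, rfl⟩
    · rw [hkey w hwf]
      exact hins.2 u hu w hwf hwA
    · have huv : f.subforestKey u ≤ f.subforestKey v := by
        rcases Finset.mem_insert.1 hu with rfl | hu
        · exact le_rfl
        · exact (h.initial.2 u hu v hv hvA).le
      refine huv.trans_lt ?_
      rw [← hkey v hv]
      exact g.subforestKey_lt_cons (by rwa [htyp v hv])
  · rw [Finset.mem_insert, not_or] at huA
    rw [hchild u huA.1]
    rcases hverts u hu with huf | ⟨k', rfl⟩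
    · exact h.leaf u huf huA.2 k
    · by_contra hne
      exact f.parent_mem _ k (List.cons_ne_nil k' v) hne (hleaf k')
  · rw [hof]
    by_cases hne : i' = i
    · rw [hne, hofi, Finset.card_insert_of_notMem hvi]
      exact hlt
    · rw [hofne i' hne]
      exact h.card_le i'
  · have hB' := hB.congr fun u hu =>
      hkey u (hins.1 ((g.mem_ofType.1 hu).1))
    rw [hof] at hB'
    by_cases hne : i' = i
    · subst hne
      rw [hofi] at hB'
      by_cases hvB : v ∈ B
      · -- all explored vertices precede `v`, so a segment that contains `v` contains them all
        have hBeq : B = insert v (f.ofType A i') := by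
          refine hB'.1.antisymm fun u hu => ?_
          by_contra huB
          rcases Finset.mem_insert.1 hu with rfl | hu'
          · exact huB hvB
          · exact absurd (hB'.2 v hvB u hu huB)
              (h.initial.2 u (f.mem_ofType.1 hu').1 v hv hvA).not_gt
        have hfull : f.IsInitial (f.ofType A i') (f.ofType A i') :=
          ⟨subset_rfl, fun _ _ w hw hw' => absurd hw hw'⟩
        rw [hBeq, Finset.card_insert_of_notMem hvi, Finset.sum_insert hvi, hstep,
          ← hold i' j _ hfull, sub_add_cancel]
      · refine hold i' j B ⟨fun u hu => (Finset.mem_insert.1 (hB'.1 hu)).resolve_left ?_,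
          fun u hu w hw hwB => hB'.2 u hu w (Finset.mem_insert_of_mem hw) hwB⟩
        rintro rfl
        exact hvB hu
    · rw [hofne i' hne] at hB'
      exact hold i' j B hB'

/-- Unexplored vertices are leaves, so every vertex is a root or the child of an explored one, and
the system evaluated at the explored numbers counts the unexplored vertices of each type. -/
theorem IsDecoding.count_add_sum_valAt (h : IsDecoding x c f A) (j : Fin d) :
    (c.count j : ℤ) + ∑ i, x.valAt i (f.ofType A i).card j =
      (f.typeVerts j).card - (f.ofType A j).card := by
  have hreach : f.reached A j = f.typeVerts j := by
    refine Finset.filter_true_of_mem fun u hu => Finset.mem_insert.2 ?_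
    rw [mem_typeVerts] at hu
    cases u with
    | nil => exact Or.inl rfl
    | cons k w =>
      refine or_iff_not_imp_left.2 fun hw => ?_
      have hw' := f.parent_mem w k hw (by simp [hu])
      by_contra hwA
      simp [h.leaf w (f.mem_verts.2 hw') hwA k] at hu
  have hbal := f.count_rootTypes_add_sum_step h.initial.1 j
  rw [hreach, h.roots] at hbal
  rw [← hbal]
  congr 1
  exact Finset.sum_congr rfl fun i _ => h.sum_step i j _
    ⟨subset_rfl, fun _ _ w hw hw' => absurd hw hw'⟩

/-- The decoding does not run out of steps: if all `x.len i` vertices of type `i` have been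
explored, then no other vertex of type `i` has been reached, as the length of `x` is a solution and
the chains of the other types have nondecreasing `i`-th coordinate. -/
theorem IsDecoding.card_ofType_lt (h : IsDecoding x c f A)
    (hsol : ∀ j, (c.count j : ℤ) + ∑ i, x.valAt i (x.len i) j = 0) {v : List ℕ} (hvA : v ∉ A)
    {i : Fin d} (hi : f.typ v = some i) : (f.ofType A i).card < x.len i := by
  refine lt_of_le_of_ne (h.card_le i) fun heq => ?_
  have hbal := h.count_add_sum_valAt i
  have hsub : f.ofType A i ⊂ f.typeVerts i :=
    Finset.ssubset_iff_subset_ne.2 ⟨(h.initial.ofType i).1, fun he =>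
      hvA (f.mem_ofType.1 (he ▸ f.mem_typeVerts.2 hi)).1⟩
  have hcard := Finset.card_lt_card hsub
  have hle : ∑ j, x.valAt j (f.ofType A j).card i ≤ ∑ j, x.valAt j (x.len j) i := by
    refine Finset.sum_le_sum fun j _ => ?_
    by_cases hji : j = i
    · rw [hji, heq]
    · exact x.valAt_mono hji (h.card_le j) le_rfl
  have := hsol i
  omega

theorem exists_isDecoding_verts
    (hsol : ∀ j, (c.count j : ℤ) + ∑ i, x.valAt i (x.len i) j = 0) :
    ∃ f, IsDecoding x c f f.verts := by
  have key : ∀ n : ℕ, (∃ f, IsDecoding x c f f.verts) ∨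
      ∃ f A, A.card = n ∧ IsDecoding x c f A := by
    intro n
    induction n with
    | zero => exact Or.inr ⟨_, ∅, rfl, isDecoding_ofRoots⟩
    | succ n ih =>
      obtain h | ⟨f, A, hcard, h⟩ := ih
      · exact Or.inl h
      by_cases hsub : f.verts ⊆ A
      · obtain rfl : f.verts = A := hsub.antisymm h.initial.1
        exact Or.inl ⟨f, h⟩
      · obtain ⟨v, hv, hvA, hmin⟩ := f.exists_first_notMem hsub
        obtain ⟨i, hi⟩ := Option.ne_none_iff_exists'.1 (f.mem_verts.1 hv)
        obtain ⟨g, hg⟩ := h.exists_insert hv hvA hmin hi (h.card_ofType_lt hsol hvA hi)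
        exact Or.inr ⟨g, insert v A, by rw [Finset.card_insert_of_notMem hvA, hcard], hg⟩
  -- at most `x.len i` vertices of each type are explored
  obtain h | ⟨f, A, hcard, h⟩ := key (∑ i, x.len i + 1)
  · exact h
  · have hsum : ((A.card : ℕ) : ℤ) = ∑ i, ((f.ofType A i).card : ℤ) := by
      simpa using (f.sum_ofType h.initial.1 fun _ => 1).symm
    have hle : ∑ i, (f.ofType A i).card ≤ ∑ i, x.len i := Finset.sum_le_sum fun i _ => h.card_le i
    have hsum' : A.card = ∑ i, (f.ofType A i).card := by exact_mod_cast hsum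
    omega

theorem exists_Psi_eq_of_isLeast {r : Fin d → ℕ} (hc : ∀ i, c.count i = r i)
    (hx : IsLeast {s | x.IsSolution r s} fun i => Fin.last (x.len i)) :
    ∃ f : TypedForest d, f.Psi = x ∧ f.rootTypes = c := by
  have hsol : ∀ j, (c.count j : ℤ) + ∑ i, x.valAt i (x.len i) j = 0 := by
    intro j
    rw [hc, ← hx.1 j]
    congr 1
    exact Finset.sum_congr rfl fun i _ => x.valAt_val i (Fin.last _) j
  obtain ⟨f, h⟩ := exists_isDecoding_verts hsol
  have hcard : ∀ i, (f.typeVerts i).card < x.len i + 1 := fun i =>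
    Nat.lt_succ_iff.2 (f.ofType_verts i ▸ h.card_le i)
  -- the explored numbers solve the system, so they are the lengths of `x` by minimality
  have hs : x.IsSolution r fun i => ⟨(f.typeVerts i).card, hcard i⟩ := by
    intro j
    have hbal := h.count_add_sum_valAt j
    simp only [ofType_verts, sub_self] at hbal
    rw [hc] at hbal
    rw [← hbal]
    congr 1
    exact Finset.sum_congr rfl fun i _ => (x.valAt_val i ⟨_, hcard i⟩ j).symm
  have hlen : ∀ i, f.Psi.len i = x.len i := fun i =>
    le_antisymm ((f.length_subforestList i).trans_le (Nat.lt_succ_iff.1 (hcard i)))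
      ((Fin.le_def.1 (hx.2 hs i)).trans_eq (f.length_subforestList i).symm)
  refine ⟨f, CodingSeq.ext_valAt hlen fun i k hk j => ?_, h.roots⟩
  have hinit := f.isInitial_take_subforestList i k
  rw [← f.card_take_subforestList hk, f.Psi_valAt hinit, h.sum_step i j _
    ((f.ofType_verts i).symm ▸ hinit)]

end TypedForest

theorem mainTheorem4 (d : ℕ) (hd : 2 ≤ d) (r : Fin d → ℕ) (hr : 0 < r) :
    Set.BijOn (TypedForest.Phi (d := d)) (forestSet r) (codingSet r ×ˢ rootSeqSet r) := by
  refine ⟨?_, TypedForest.Phi_injective.injOn, ?_⟩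
  · rintro f ⟨-, htypes, hroot⟩
    refine ⟨⟨fun i => ?_, f.isLeast_len_Psi hroot.2⟩, hroot⟩
    obtain ⟨u, hu⟩ := htypes i
    exact (Finset.card_pos.2 ⟨u, f.mem_typeVerts.2 hu⟩).trans_eq (f.length_subforestList i).symm
  · rintro ⟨x, c⟩ ⟨⟨hlen, hx⟩, hc⟩
    obtain ⟨f, rfl, rfl⟩ := TypedForest.exists_Psi_eq_of_isLeast hc.2 hx
    refine ⟨f, ⟨f.length_rootTypes.symm.trans hc.1, fun i => ?_, hc⟩, rfl⟩
    obtain ⟨u, hu⟩ := Finset.card_pos.1 ((hlen i).trans_eq (f.length_subforestList i))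
    exact ⟨u, f.mem_typeVerts.1 hu⟩
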